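/- Let $\mathcal H$ be a real separable Hilbert space ($\mathbb R^p$ or $\ell_2$), and let $x$ be a random vector in $\mathcal H$ with $\mathbb E\|x\|^2<\infty$ and (uncentered) covariance operator $\Sigma=\mathbb E[xx^{\mathsf T}]\neq 0$, which is diagonal, $\Sigma=\mathrm{diag}(\xi_1',\xi_2',\dots)$, in some orthonormal basis. Denote $\gamma=\mathrm{Tr}(\Sigma)$ and $\xi_1=\|\Sigma\|_{\rm op}$. Let $\mathsf c_x,\mathsf C_x,\beta>0$ and suppose that $x$ has concentrated features with these constants: for every bounded positive semidefinite operator $A$ on $\mathcal H$ with $\Sigma^{1/2}A\Sigma^{1/2}\neq 0$ and every $t>0$, $$\mathbb P\Big(\big|x^{\mathsf T}Ax-\mathrm{Tr}(\Sigma A)\big|\ge t\,\|\Sigma^{1/2}A\Sigma^{1/2}\|_F\Big)\le \mathsf C_x\exp\{-\mathsf c_x t^{1/\beta}\}.$$ Let $n\ge 1$, let $x_1,\dots,x_n$ be i.i.d. copies of $x$, let $K=(\langle x_i,x_j\rangle)_{i,j\in[n]}\in\mathbb R^{n\times n}$ be their Gram matrix, and assume that $n\xi_1/\gamma\le 1/2$.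 Then for every $D>0$ there is a constant $C_{x,D}>0$, depending only on $\mathsf c_x,\mathsf C_x,\beta,D$, such that with probability at least $1-n^{-D}$ $$\|K-\gamma I_n\|_{\rm op}\le C_{x,D}\,\log^{2\beta+1}(n)\,\gamma\,\sqrt{\frac{n\xi_1}{\gamma}}.$$ -/

import Mathlib

open MeasureTheory ProbabilityTheory

namespace ConcentratedFeatures

/-- The (raw) covariance operator `Σ = E[x xᵀ]` of a random vector with law `μ`. -/
noncomputable def secondMoment {H : Type*} [NormedAddCommGroup H] [InnerProductSpace ℝ H]
    [MeasurableSpace H] (μ : Measure H) : H →L[ℝ] H :=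
  ∫ x, InnerProductSpace.rankOne ℝ x x ∂μ

/-- The trace of a bounded operator, computed in an orthonormal basis. -/
noncomputable def opTrace {ι H : Type*} [NormedAddCommGroup H] [InnerProductSpace ℝ H]
    (b : HilbertBasis ι ℝ H) (T : H →L[ℝ] H) : ℝ :=
  ∑' j, inner ℝ (b j) (T (b j))

/-- The features with law `μ` have finite second moment `E‖x‖² < ∞` (so that `Σ` is trace class)
and, in the orthonormal basis `b`, their covariance is `Σ = diag (ξ j)`. -/
structure HasDiagonalCovariance {ι H : Type*} [NormedAddCommGroup H] [InnerProductSpace ℝ H]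
    [MeasurableSpace H] (μ : Measure H) (b : HilbertBasis ι ℝ H) (ξ : ι → ℝ) : Prop where
  memLp : MemLp id 2 μ
  diagonal : ∀ j, secondMoment μ (b j) = ξ j • b j

/-- The Frobenius norm `‖Σ^{1/2} A Σ^{1/2}‖_F`, where `Σ = diag (ξ j)` in the basis `b`: the
`(j, k)` entry of `Σ^{1/2} A Σ^{1/2}` is `√(ξ j) * A j k * √(ξ k)`. -/
noncomputable def sandwichFrobenius {ι H : Type*} [NormedAddCommGroup H] [InnerProductSpace ℝ H]
    (b : HilbertBasis ι ℝ H) (ξ : ι → ℝ) (A : H →L[ℝ] H) : ℝ :=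
  √(∑' p : ι × ι, (√(ξ p.1) * inner ℝ (b p.1) (A (b p.2)) * √(ξ p.2)) ^ 2)

/-- Concentrated features, with constants `c`, `C`, `β`: for every positive semidefinite `A`,
the quadratic form `xᵀ A x` concentrates around `Tr (Σ A)` at the scale `‖Σ^{1/2} A Σ^{1/2}‖_F`.
The degenerate case `Σ^{1/2} A Σ^{1/2} = 0`, where the inequality would read
`1 ≤ C * exp (-c * t ^ (1 / β))` for all `t`, is excluded. -/
def IsConcentrated {ι H : Type*} [NormedAddCommGroup H] [InnerProductSpace ℝ H] [CompleteSpace H]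
    [MeasurableSpace H] (μ : Measure H) (b : HilbertBasis ι ℝ H) (ξ : ι → ℝ) (c C β : ℝ) : Prop :=
  ∀ A : H →L[ℝ] H, A.IsPositive → 0 < sandwichFrobenius b ξ A → ∀ t : ℝ, 0 < t →
    μ.real {x | t * sandwichFrobenius b ξ A ≤
        |inner ℝ x (A x) - opTrace b (secondMoment μ ∘L A)|}
      ≤ C * Real.exp (-c * t ^ (1 / β))

end ConcentratedFeatures

/-!
The Gram matrix is built one sample at a time, and a potential controls the resolvent of the Gram
matrix at a point outside its spectrum; no matrix concentration inequality is needed.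

For a sign `s = ±1` and a level `h`, put `N = h - s (K_k - γ)`, where `K_k` is the Gram matrix of
the first `k` samples (`barrier`). If `N` is positive definite at some level `≤ h` for both signs,
then `‖K_k - γ‖ ≤ h`. Adding a sample `y` borders `N` by the vector `-s v`, `v a = ⟪x a, y⟫`, and by
the corner `h - s (‖y‖² - γ)`. By the Schur complement the bordered matrix stays positive definite
as long as `σ = h - s (‖y‖² - γ) - vᵀ N⁻¹ v > 0`, and the potential `tr N⁻¹` grows by
`(1 + vᵀ N⁻² v) / σ` (`barrier_succ`). Both `vᵀ N⁻¹ v` and `vᵀ N⁻² v` are quadratic forms `yᵀ A y`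
in the new sample with `A` positive semidefinite and independent of `y`, so the concentration
hypothesis bounds them by `1 + t` times their conditional means, up to a small slack. As
`Tr (Σ A) ≤ ‖Σ‖ Tr A` and `s N = z - K_k` with `z = γ + s h`, the means are at most
`‖Σ‖ (z tr N⁻¹ - s k)` and `‖Σ‖ (z tr N⁻² - s tr N⁻¹)`.

The first bound is of order `n ‖Σ‖ γ / h` when `tr N⁻¹` is of order `n / h`; it is below `h` as soon
as `h ≫ √(n ‖Σ‖ γ)`, the scale of the theorem. The second one involves `tr N⁻²`, which the
induction does not control; raising the level by `h / n` before each new sample lowers `tr N⁻¹` by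
at least `(h / n) tr N⁻²`, taken at the raised level (`trace_inv_add_smul_one_le`), and this pays
for it. Hence with
`h = 64 (1 + t) √(n ‖Σ‖ γ)` the potential stays below `4 k / h` while the level grows from `h` to
`2 h` (`barrier_posDef_of_goodSample`). Each sample misbehaves with probability at most
`5 C exp (-c t ^ (1 / β))` (`IsConcentrated.not_goodSample_le`), and `t` of order `(log n) ^ β` makes
the union bound over `n` samples at most `n ^ (-D)`. This yields the power `β` of the logarithm,
which is below `2 β + 1`.
-/

namespace ConcentratedFeatures

/-! ### Bordered matrices and traces of inverses -/


open Matrix in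
theorem posDef_fromBlocks_border {m : Type*} [Fintype m] [DecidableEq m] {N : Matrix m m ℝ}
    (hN : N.PosDef) (v : m → ℝ) (a : ℝ) (ha : v ⬝ᵥ N⁻¹ *ᵥ v < a) :
    (fromBlocks N (replicateCol (Fin 1) v) (replicateRow (Fin 1) v)
      (Matrix.of fun _ _ => a)).PosDef := by
  let : Invertible N := hN.isUnit.invertible
  have hB : (replicateCol (Fin 1) v)ᴴ = replicateRow (Fin 1) v := by
    ext i j; simp [conjTranspose_apply]
  have hS : (Matrix.of fun _ _ => a) - replicateRow (Fin 1) v * N⁻¹ * replicateCol (Fin 1) v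
      = (a - v ⬝ᵥ N⁻¹ *ᵥ v) • (1 : Matrix (Fin 1) (Fin 1) ℝ) := by
    ext i j
    rw [Subsingleton.elim i j, Matrix.mul_assoc]
    simp [Matrix.mul_apply, dotProduct, mulVec]
  have hpsd := (PosDef.fromBlocks₁₁ (replicateCol (Fin 1) v) (Matrix.of fun _ _ => a) hN).2
    (by rw [hB, hS]; exact PosSemidef.one.smul (by linarith))
  rw [hB] at hpsd
  rw [hpsd.posDef_iff_det_ne_zero, det_fromBlocks₁₁, invOf_eq_nonsing_inv, hS]
  have := hN.det_pos
  simp only [det_smul, det_one, Fintype.card_fin, pow_one, mul_one]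
  exact mul_ne_zero this.ne' (by linarith)

open Matrix in
theorem trace_inv_fromBlocks_border {m : Type*} [Fintype m] [DecidableEq m] {N : Matrix m m ℝ}
    (hN : N.PosDef) (v : m → ℝ) (a : ℝ) (ha : v ⬝ᵥ N⁻¹ *ᵥ v < a) :
    (fromBlocks N (replicateCol (Fin 1) v) (replicateRow (Fin 1) v)
      (Matrix.of fun _ _ => a))⁻¹.trace
      = N⁻¹.trace + (1 + v ⬝ᵥ (N⁻¹ * N⁻¹) *ᵥ v) / (a - v ⬝ᵥ N⁻¹ *ᵥ v) := by
  have hP := posDef_fromBlocks_border hN v a ha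
  let : Invertible N := hN.isUnit.invertible
  have hσ : a - v ⬝ᵥ N⁻¹ *ᵥ v ≠ 0 := by linarith
  have hS : (Matrix.of fun _ _ => a) - replicateRow (Fin 1) v * ⅟N * replicateCol (Fin 1) v
      = (a - v ⬝ᵥ N⁻¹ *ᵥ v) • (1 : Matrix (Fin 1) (Fin 1) ℝ) := by
    ext i j
    rw [Subsingleton.elim i j, Matrix.mul_assoc]
    simp [Matrix.mul_apply, dotProduct, mulVec]
  let : Invertible ((a - v ⬝ᵥ N⁻¹ *ᵥ v) • (1 : Matrix (Fin 1) (Fin 1) ℝ)) :=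
    ⟨(a - v ⬝ᵥ N⁻¹ *ᵥ v)⁻¹ • 1, by simp [smul_smul, hσ], by simp [smul_smul, hσ]⟩
  let : Invertible ((Matrix.of fun _ _ => a) -
      replicateRow (Fin 1) v * ⅟N * replicateCol (Fin 1) v) := Invertible.copy ‹_› _ hS
  have hSinv : ⅟((Matrix.of fun _ _ => a) - replicateRow (Fin 1) v * ⅟N * replicateCol (Fin 1) v)
      = (a - v ⬝ᵥ N⁻¹ *ᵥ v)⁻¹ • 1 := rfl
  let : Invertible (fromBlocks N (replicateCol (Fin 1) v) (replicateRow (Fin 1) v)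
      (Matrix.of fun _ _ => a)) := hP.isUnit.invertible
  rw [← invOf_eq_nonsing_inv, invOf_fromBlocks₁₁_eq, hSinv, Matrix.trace, Fintype.sum_sum_type]
  simp only [diag_apply, fromBlocks_apply₁₁, fromBlocks_apply₂₂]
  change (⅟N + _).trace + Matrix.trace (_ • 1) = _
  rw [trace_add]
  have : (⅟N * replicateCol (Fin 1) v * ((a - v ⬝ᵥ N⁻¹ *ᵥ v)⁻¹ • (1 : Matrix (Fin 1) (Fin 1) ℝ))
      * replicateRow (Fin 1) v * ⅟N).trace
      = (a - v ⬝ᵥ N⁻¹ *ᵥ v)⁻¹ * (v ⬝ᵥ (N⁻¹ * N⁻¹) *ᵥ v) := by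
    rw [invOf_eq_nonsing_inv, Matrix.mul_smul, Matrix.mul_one, Matrix.smul_mul, Matrix.smul_mul,
      trace_smul, Matrix.mul_assoc (N⁻¹ * _), trace_mul_comm, ← Matrix.mul_assoc,
      Matrix.mul_assoc (replicateRow (Fin 1) v), Matrix.mul_assoc (replicateRow (Fin 1) v)]
    simp [Matrix.trace, Matrix.mul_apply, dotProduct, mulVec]
  rw [this, invOf_eq_nonsing_inv]
  simp only [trace_smul, trace_one, Fintype.card_fin, smul_eq_mul]
  push_cast
  ring

open Matrix in
/-- Shifting a positive definite matrix by `δ` lowers the trace of its inverse at least by the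
first-order amount `δ tr (N + δ)⁻²`, by convexity. -/
theorem trace_inv_add_smul_one_le {m : Type*} [Fintype m] [DecidableEq m] {N : Matrix m m ℝ}
    (hN : N.PosDef) {δ : ℝ} (hδ : 0 < δ) :
    (N + δ • 1)⁻¹.trace + δ * ((N + δ • 1)⁻¹ * (N + δ • 1)⁻¹).trace ≤ N⁻¹.trace := by
  have hN' : (N + δ • 1).PosDef := hN.add (PosDef.one.smul hδ)
  set G := (N + δ • 1)⁻¹ with hG
  have hu : IsUnit N.det := (isUnit_iff_isUnit_det _).1 hN.isUnit
  have hu' : IsUnit (N + δ • 1).det := (isUnit_iff_isUnit_det _).1 hN'.isUnit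
  have key : N⁻¹ = G + δ • (N⁻¹ * G) := by
    calc N⁻¹ = N⁻¹ * ((N + δ • 1) * G) := by rw [hG, mul_nonsing_inv _ hu', Matrix.mul_one]
      _ = G + δ • (N⁻¹ * G) := by
        rw [add_mul, mul_add, ← Matrix.mul_assoc, nonsing_inv_mul _ hu]
        simp
  have h0 : 0 ≤ (G * N⁻¹ * G).trace := by
    have hGh : Gᴴ = G := hN'.inv.isHermitian
    have := hN.inv.posSemidef.conjTranspose_mul_mul_same G
    rw [hGh] at this
    exact this.trace_nonneg
  have h1 : N⁻¹.trace = G.trace + δ * (N⁻¹ * G).trace := by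
    conv_lhs => rw [key]
    simp
  have h2 : (N⁻¹ * G).trace = (G * G).trace + δ * (G * N⁻¹ * G).trace := by
    conv_lhs => rw [key]
    rw [add_mul, smul_mul, trace_add, trace_smul, smul_eq_mul, trace_mul_comm (N⁻¹ * G),
      Matrix.mul_assoc]
  rw [h1, h2]
  nlinarith [mul_nonneg (mul_nonneg hδ.le hδ.le) h0]

open Matrix in
/-- For a symmetric matrix, `-R ≤ M ≤ R` in the Loewner order bounds the operator norm by `R`, since
the norm is the supremum of the absolute Rayleigh quotients. -/
theorem norm_toEuclideanCLM_le {m : Type*} [Fintype m] [DecidableEq m] {M : Matrix m m ℝ}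
    (hM : M.IsHermitian) {R : ℝ} (hR : 0 ≤ R) (h₁ : (R • 1 - M).PosSemidef)
    (h₂ : (R • 1 + M).PosSemidef) : ‖toEuclideanCLM (𝕜 := ℝ) M‖ ≤ R := by
  have hsym : (toEuclideanCLM (𝕜 := ℝ) M :
      EuclideanSpace ℝ m →L[ℝ] EuclideanSpace ℝ m).IsSymmetric := by
    intro x y
    change inner ℝ (toEuclideanCLM (𝕜 := ℝ) M x) y = inner ℝ x (toEuclideanCLM (𝕜 := ℝ) M y)
    rw [real_inner_comm, inner_toEuclideanCLM, inner_toEuclideanCLM, dotProduct_mulVec,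
      dotProduct_comm, ← mulVec_transpose]
    have : Mᵀ = M := hM
    rw [this]
  rw [ContinuousLinearMap.norm_eq_iSup_rayleighQuotient _ hsym]
  refine ciSup_le fun x => ?_
  have hx : inner ℝ x (toEuclideanCLM (𝕜 := ℝ) M x) = x ⬝ᵥ M *ᵥ x := inner_toEuclideanCLM M x x
  have hxx : x.ofLp ⬝ᵥ x.ofLp = ‖x‖ ^ 2 := by
    rw [EuclideanSpace.real_norm_sq_eq]; simp [dotProduct, sq]
  have e₁ := h₁.dotProduct_mulVec_nonneg x.ofLp
  have e₂ := h₂.dotProduct_mulVec_nonneg x.ofLp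
  simp only [star_trivial, sub_mulVec, add_mulVec, smul_mulVec, one_mulVec, dotProduct_sub,
    dotProduct_add, dotProduct_smul, hxx, smul_eq_mul] at e₁ e₂
  rw [ContinuousLinearMap.rayleighQuotient, ContinuousLinearMap.reApplyInnerSelf_apply,
    real_inner_comm, hx, abs_div, abs_of_nonneg (sq_nonneg ‖x‖)]
  refine div_le_of_le_mul₀ (sq_nonneg _) hR ?_
  rw [RCLike.re_to_real, abs_le]
  constructor <;> linarith

/-! ### The barrier argument for the Gram matrix -/


/-- The matrix `h - s (K - γ)`, where `K` is the Gram matrix of `X`. It is meant for `s = ±1`: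
positive definiteness says that the spectrum of `K` lies below `γ + h` when `s = 1`, and above
`γ - h` when `s = -1`. -/
noncomputable def barrier {H : Type*} [NormedAddCommGroup H] [InnerProductSpace ℝ H] {k : ℕ}
    (X : Fin k → H) (s γ h : ℝ) : Matrix (Fin k) (Fin k) ℝ :=
  h • 1 - s • (Matrix.gram ℝ X - γ • 1)

/-- The quadratic form `vᵀ M v` at the vector `v a = ⟪X a, y⟫` of inner products of the sample
points with `y`. -/
noncomputable def sampleForm {H : Type*} [NormedAddCommGroup H] [InnerProductSpace ℝ H] {k : ℕ}
    (X : Fin k → H) (M : Matrix (Fin k) (Fin k) ℝ) (y : H) : ℝ :=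
  (fun a => inner ℝ (X a) y) ⬝ᵥ M.mulVec (fun a => inner ℝ (X a) y)

section Barrier

variable {H : Type*} [NormedAddCommGroup H] [InnerProductSpace ℝ H] {k : ℕ}

theorem gram_eq_sub_smul_barrier (X : Fin k → H) {s : ℝ} (hs : s * s = 1) (γ h : ℝ) :
    Matrix.gram ℝ X = (γ + s * h) • 1 - s • barrier X s γ h := by
  rw [barrier, smul_sub, smul_smul, smul_smul, hs, one_smul, add_smul]
  abel

theorem barrier_add (X : Fin k → H) (s γ h δ : ℝ) :
    barrier X s γ (h + δ) = barrier X s γ h + δ • 1 := by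
  rw [barrier, barrier, add_smul]
  abel

theorem trace_inv_barrier_mul_gram (X : Fin k → H) {s : ℝ} (hs : s * s = 1) {γ h : ℝ}
    (hN : (barrier X s γ h).PosDef) :
    ((barrier X s γ h)⁻¹ * Matrix.gram ℝ X).trace
      = (γ + s * h) * (barrier X s γ h)⁻¹.trace - s * k := by
  have hu : IsUnit (barrier X s γ h).det := (Matrix.isUnit_iff_isUnit_det _).1 hN.isUnit
  rw [gram_eq_sub_smul_barrier X hs γ h, mul_sub, Matrix.mul_smul, Matrix.mul_smul,
    Matrix.nonsing_inv_mul _ hu]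
  simp

theorem trace_inv_sq_barrier_mul_gram (X : Fin k → H) {s : ℝ} (hs : s * s = 1) {γ h : ℝ}
    (hN : (barrier X s γ h).PosDef) :
    ((barrier X s γ h)⁻¹ * (barrier X s γ h)⁻¹ * Matrix.gram ℝ X).trace
      = (γ + s * h) * ((barrier X s γ h)⁻¹ * (barrier X s γ h)⁻¹).trace
        - s * (barrier X s γ h)⁻¹.trace := by
  have hu : IsUnit (barrier X s γ h).det := (Matrix.isUnit_iff_isUnit_det _).1 hN.isUnit
  rw [gram_eq_sub_smul_barrier X hs γ h, mul_sub, Matrix.mul_smul, Matrix.mul_smul,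
    Matrix.mul_assoc _ _ (barrier X s γ h), Matrix.nonsing_inv_mul _ hu]
  simp

theorem barrier_submatrix_succ (Y : Fin (k + 1) → H) (s γ h : ℝ) :
    (barrier Y s γ h).submatrix (finSumFinEquiv (m := k) (n := 1)) finSumFinEquiv
      = Matrix.fromBlocks (barrier (fun i => Y i.castSucc) s γ h)
        (Matrix.replicateCol (Fin 1) fun a => -s * inner ℝ (Y a.castSucc) (Y (Fin.last k)))
        (Matrix.replicateRow (Fin 1) fun a => -s * inner ℝ (Y a.castSucc) (Y (Fin.last k)))
        (Matrix.of fun _ _ => h - s * (‖Y (Fin.last k)‖ ^ 2 - γ)) := by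
  have e₁ : ∀ a : Fin k, (finSumFinEquiv (m := k) (n := 1)) (Sum.inl a) = a.castSucc :=
    fun _ => rfl
  have e₂ : ∀ a : Fin 1, (finSumFinEquiv (m := k) (n := 1)) (Sum.inr a) = Fin.last k := by
    intro a; rw [Subsingleton.elim a 0]; rfl
  ext i j
  rcases i with i | i <;> rcases j with j | j <;>
    simp only [Matrix.submatrix_apply, e₁, e₂, Matrix.fromBlocks_apply₁₁,
      Matrix.fromBlocks_apply₁₂, Matrix.fromBlocks_apply₂₁, Matrix.fromBlocks_apply₂₂]
  · simp [barrier, Matrix.gram_apply, Matrix.one_apply]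
  · simp [barrier, Matrix.gram_apply, (Fin.castSucc_lt_last i).ne]
  · simp [barrier, Matrix.gram_apply, (Fin.castSucc_lt_last j).ne',
      real_inner_comm]
  · simp [barrier, Matrix.gram_apply]

/-- The effect of one more sample on positive definiteness and on the potential `tr N⁻¹`. The sign
`-s` in the border disappears, since it enters every quadratic form twice. -/
theorem barrier_succ (Y : Fin (k + 1) → H) {s : ℝ} (hs : s * s = 1) {γ h : ℝ}
    (hN : (barrier (fun i => Y i.castSucc) s γ h).PosDef)
    (hp : sampleForm (fun i => Y i.castSucc) (barrier (fun i => Y i.castSucc) s γ h)⁻¹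
      (Y (Fin.last k)) < h - s * (‖Y (Fin.last k)‖ ^ 2 - γ)) :
    (barrier Y s γ h).PosDef ∧
      (barrier Y s γ h)⁻¹.trace = (barrier (fun i => Y i.castSucc) s γ h)⁻¹.trace +
        (1 + sampleForm (fun i => Y i.castSucc) ((barrier (fun i => Y i.castSucc) s γ h)⁻¹ *
            (barrier (fun i => Y i.castSucc) s γ h)⁻¹) (Y (Fin.last k)))
          / (h - s * (‖Y (Fin.last k)‖ ^ 2 - γ) -
            sampleForm (fun i => Y i.castSucc) (barrier (fun i => Y i.castSucc) s γ h)⁻¹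
              (Y (Fin.last k))) := by
  have hform : ∀ M : Matrix (Fin k) (Fin k) ℝ,
      (fun a : Fin k => -s * inner ℝ (Y a.castSucc) (Y (Fin.last k))) ⬝ᵥ
        M.mulVec (fun a => -s * inner ℝ (Y a.castSucc) (Y (Fin.last k)))
      = sampleForm (fun i => Y i.castSucc) M (Y (Fin.last k)) := by
    intro M
    have : (fun a : Fin k => -s * inner ℝ (Y a.castSucc) (Y (Fin.last k)))
      = (-s) • (fun a : Fin k => inner ℝ (Y a.castSucc) (Y (Fin.last k))) := rfl
    rw [this, Matrix.mulVec_smul, smul_dotProduct, dotProduct_smul, smul_smul, neg_mul_neg, hs,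
      one_smul, sampleForm]
  have hb := barrier_submatrix_succ Y s γ h
  rw [← hform] at hp
  have h₁ := posDef_fromBlocks_border hN _ _ hp
  have h₂ := trace_inv_fromBlocks_border hN _ _ hp
  rw [← hb] at h₁ h₂
  rw [hform, hform] at h₂
  constructor
  · have := h₁.submatrix (e := finSumFinEquiv.symm) finSumFinEquiv.symm.injective
    simpa using this
  · rw [← h₂, Matrix.inv_submatrix_equiv]
    exact (Equiv.sum_comp finSumFinEquiv fun i => (barrier Y s γ h)⁻¹ i i).symm

end Barrier

/-- The numerical core of the induction. Here `Φ` and `T` stand for the traces of `N⁻¹` and `N⁻²`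
after the shift of the level by `h / n`, `d` for the signed deviation of the squared norm of the new
sample, and `p`, `q` for its quadratic forms in `N⁻¹` and `N⁻²`. The term `(h / n) * T` gained by the
shift absorbs the contribution of `T` to `q`. -/
theorem potential_step_bound {n k ξ γ τ r h h' Φ T d p q : ℝ} (hn : 1 ≤ n) (hk : k ≤ n)
    (hξ : 0 < ξ) (hγ : 0 < γ) (hτ : 1 ≤ τ) (hr : 0 < r) (hr2 : r ^ 2 = n * ξ * γ)
    (hnξ : n * ξ ≤ r) (hh : h = 64 * τ * r) (hh' : h ≤ h') (hT : 0 ≤ T)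
    (hΦT : Φ + h / n * T ≤ 4 * k / h) (hd : d ≤ τ * r)
    (hp : p ≤ τ * (ξ * ((γ + 2 * h) * Φ + n) + ξ))
    (hq : q ≤ τ * (ξ * ((γ + 2 * h) * T + Φ) + ξ / h)) :
    h / 2 ≤ h' - d - p ∧ Φ + (1 + q) / (h' - d - p) ≤ 4 * (k + 1) / h := by
  have hh0 : 0 < h := by rw [hh]; positivity
  have hδT : 0 ≤ h / n * T := by positivity
  have hτr : r ≤ τ * r := le_mul_of_one_le_left hr.le hτ
  -- The potential before the step bounds the forms through `ξ h Φ ≤ 4 n ξ ≤ 4 r` and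
  -- `ξ γ Φ ≤ 4 r² / h ≤ r / 16`; together they leave more than `h / 2 = 32 τ r` for `h' - d - p`.
  have hΦn : h * Φ ≤ 4 * n := by
    have : Φ ≤ 4 * n / h := by
      refine le_trans (by linarith) (hΦT.trans ?_)
      gcongr
    rwa [le_div_iff₀ hh0, mul_comm] at this
  have hξn : ξ ≤ n * ξ := le_mul_of_one_le_left hξ.le hn
  have hξγ : ξ * γ * Φ ≤ r / 16 := by
    have h1 : h * (ξ * γ * Φ) ≤ 4 * r ^ 2 := by
      rw [hr2]
      nlinarith [mul_le_mul_of_nonneg_left hΦn (mul_nonneg hξ.le hγ.le)]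
    have h2 : 4 * r ^ 2 ≤ h * (r / 16) := by rw [hh]; nlinarith
    exact le_of_mul_le_mul_left (h1.trans h2) hh0
  have hξΦ : ξ * (h * Φ) ≤ 4 * r := by nlinarith
  have hp' : p ≤ 11 * (τ * r) := by
    have : ξ * ((γ + 2 * h) * Φ + n) + ξ ≤ 11 * r := by nlinarith
    nlinarith
  have hσ : h / 2 ≤ h' - d - p := by nlinarith
  refine ⟨hσ, ?_⟩
  -- The choice of `h` makes `τ ξ (γ + 2 h) ≤ h² / (2 n)`, so that division by `h / 2` turns the
  -- contribution of `T` into at most `(h / n) * T`.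
  have hq' : 1 + q ≤ 2 + h / 2 * (h / n * T) := by
    have h1 : τ * (ξ * (γ + 2 * h)) * T ≤ h / 2 * (h / n * T) := by
      have : τ * (ξ * (γ + 2 * h)) ≤ h / 2 * (h / n) := by
        rw [div_mul_div_comm, le_div_iff₀ (by positivity)]
        have a1 : τ * (n * ξ) * h ≤ τ * r * h := by gcongr
        have a2 : τ * r ^ 2 ≤ τ * r * h := by
          rw [sq, ← mul_assoc]; gcongr; rw [hh]; nlinarith
        have a3 : h * h = 64 * (τ * r * h) := by rw [hh]; ring
        have a4 : 0 ≤ τ * r * h := by positivity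
        rw [a3]
        rw [hr2] at a2
        linarith
      calc _ ≤ h / 2 * (h / n) * T := by gcongr
        _ = _ := by ring
    have h2 : τ * ξ * Φ ≤ 1 / 16 := by
      have : h * (τ * ξ * Φ) ≤ h * (1 / 16) := by
        have : h * (τ * ξ * Φ) = τ * (ξ * (h * Φ)) := by ring
        rw [this, hh]
        have := mul_le_mul_of_nonneg_left hξΦ (by linarith : (0:ℝ) ≤ τ)
        rw [hh] at this
        linarith
      exact le_of_mul_le_mul_left this hh0
    have h3 : τ * (ξ / h) ≤ 1 / 16 := by
      rw [← mul_div_assoc, div_le_iff₀ hh0, hh]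
      nlinarith
    linarith
  have hσ0 : 0 < h' - d - p := by linarith
  have hfrac : (1 + q) / (h' - d - p) ≤ 4 / h + h / n * T := by
    rw [div_le_iff₀ hσ0]
    calc 1 + q ≤ 2 + h / 2 * (h / n * T) := hq'
      _ = (4 / h + h / n * T) * (h / 2) := by field_simp; ring
      _ ≤ _ := by gcongr
  have : 4 * (k + 1) / h = 4 * k / h + 4 / h := by ring
  linarith

/-- The new sample `y` is well-behaved with respect to the earlier ones `X`: its quadratic forms in
the inverse barrier and in its square at the level `h'` are at most `1 + t` times the bounds on
their means, and its squared norm is close to `γ`. The parameter `ξ` is the operator norm of the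
covariance. The terms `ξ` and `ξ / h` are slack: they keep the statement about the tail true for
forms whose mean vanishes. Positive semidefiniteness is a premise, as the concentration hypothesis
applies only to positive semidefinite forms. -/
structure GoodSample {H : Type*} [NormedAddCommGroup H] [InnerProductSpace ℝ H] {k : ℕ}
    (X : Fin k → H) (y : H) (ξ γ h h' s t : ℝ) : Prop where
  inv : (barrier X s γ h')⁻¹.PosSemidef →
    sampleForm X (barrier X s γ h')⁻¹ y
      < (1 + t) * (ξ * ((barrier X s γ h')⁻¹ * Matrix.gram ℝ X).trace + ξ)
  inv_sq : ((barrier X s γ h')⁻¹ * (barrier X s γ h')⁻¹).PosSemidef →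
    sampleForm X ((barrier X s γ h')⁻¹ * (barrier X s γ h')⁻¹) y
      < (1 + t) * (ξ * ((barrier X s γ h')⁻¹ * (barrier X s γ h')⁻¹ * Matrix.gram ℝ X).trace
        + ξ / h)
  norm_sq : |‖y‖ ^ 2 - γ| < t * √(ξ * γ)

/-- If every sample is well-behaved with respect to its predecessors, the barrier is positive
definite. The invariant is that, after `k` samples and at level `h + k h / n`, the barrier is positive
definite and the trace of its inverse is at most `4 k / h`. -/
theorem barrier_posDef_of_goodSample {H : Type*} [NormedAddCommGroup H] [InnerProductSpace ℝ H]
    {n : ℕ} (x : Fin n → H) {ξ γ t s h : ℝ} (hn : 0 < n) (hξ : 0 < ξ) (hγ : 0 < γ)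
    (ht : 0 ≤ t) (hs : s = 1 ∨ s = -1) (hnξ : n * ξ / γ ≤ 1 / 2)
    (hh : h = 64 * (1 + t) * √(n * ξ * γ))
    (hgood : ∀ k : ℕ, ∀ hk : k < n,
      GoodSample (fun i : Fin k => x (Fin.castLE hk.le i)) (x ⟨k, hk⟩) ξ γ h
        (h + (k + 1) * (h / n)) s t) :
    (barrier x s γ (2 * h)).PosDef := by
  have hn1 : (1 : ℝ) ≤ n := by exact_mod_cast hn
  have hn0 : (0 : ℝ) < n := by linarith
  have hss : s * s = 1 := by rcases hs with rfl | rfl <;> norm_num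
  have habs : |s| = 1 := by rcases hs with rfl | rfl <;> norm_num
  set r := √(n * ξ * γ) with hr_def
  have hr2 : r ^ 2 = n * ξ * γ := Real.sq_sqrt (by positivity)
  have hr : 0 < r := Real.sqrt_pos.2 (by positivity)
  have hnξr : n * ξ ≤ r := by
    rw [div_le_iff₀ hγ] at hnξ
    refine Real.le_sqrt_of_sq_le ?_
    have : 0 < n * ξ := by positivity
    nlinarith
  have hξr : √(ξ * γ) ≤ r := Real.sqrt_le_sqrt (by nlinarith [mul_pos hξ hγ])
  have hh0 : 0 < h := by rw [hh]; positivity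
  have main : ∀ k : ℕ, ∀ hk : k ≤ n,
      (barrier (fun i : Fin k => x (Fin.castLE hk i)) s γ (h + k * (h / n))).PosDef ∧
      (barrier (fun i : Fin k => x (Fin.castLE hk i)) s γ (h + k * (h / n)))⁻¹.trace
        ≤ 4 * k / h := by
    intro k
    induction k with
    | zero =>
      intro hk
      refine ⟨⟨Subsingleton.elim _ _, fun v hv => absurd (Subsingleton.elim _ _) hv⟩, ?_⟩
      simp
    | succ k ih =>
      intro hk
      obtain ⟨hN, hΦ⟩ := ih (by omega)
      have hkn : k < n := hk
      obtain ⟨g₁, g₂, g₃⟩ := hgood k hkn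
      set X : Fin k → H := fun i => x (Fin.castLE hkn.le i) with hX
      set Y : Fin (k + 1) → H := fun i => x (Fin.castLE hk i) with hY
      have hYX : (fun i : Fin k => Y i.castSucc) = X := rfl
      have hYl : Y (Fin.last k) = x ⟨k, hkn⟩ := rfl
      have hδ : 0 < h / n := by positivity
      have hh' : h + ((k + 1 : ℕ) : ℝ) * (h / n) = h + k * (h / n) + h / n := by
        push_cast; ring
      have hh'' : h + ((k : ℝ) + 1) * (h / n) = h + k * (h / n) + h / n := by ring
      rw [hh''] at g₁ g₂
      rw [hh']
      have hpot := trace_inv_add_smul_one_le hN hδ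
      have hN' := hN.add (Matrix.PosDef.one.smul hδ)
      rw [← barrier_add] at hpot hN'
      set h' := h + k * (h / n) + h / n with hh'_def
      have hbX := trace_inv_barrier_mul_gram X hss hN'
      have hbX2 := trace_inv_sq_barrier_mul_gram X hss hN'
      set G := (barrier X s γ h')⁻¹ with hG
      have hGpd : G.PosDef := hN'.inv
      have hGG : (G * G).PosSemidef := by
        have hGh : G.conjTranspose = G := hGpd.isHermitian
        have := Matrix.posSemidef_conjTranspose_mul_self G
        rwa [hGh] at this
      have hG0 : 0 ≤ G.trace := hGpd.posSemidef.trace_nonneg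
      have hGG0 : 0 ≤ (G * G).trace := hGG.trace_nonneg
      have hkn' : (k : ℝ) + 1 ≤ n := by exact_mod_cast hkn
      have hh'le : h' ≤ 2 * h := by
        have : (k + 1) * (h / n) ≤ n * (h / n) := by gcongr
        rw [mul_div_cancel₀ _ hn0.ne'] at this
        rw [← hh'']
        linarith
      have hh'ge : h ≤ h' := by
        have : 0 ≤ k * (h / n) := by positivity
        linarith
      have hz : γ + s * h' ≤ γ + 2 * h := by
        have : s * h' ≤ |s| * h' := by gcongr; exact le_abs_self s
        rw [habs] at this
        linarith
      have hp := (g₁ hGpd.posSemidef).le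
      have hq := (g₂ hGG).le
      rw [hbX] at hp
      rw [hbX2] at hq
      have hs' : -s ≤ 1 := by rcases hs with rfl | rfl <;> norm_num
      have hd : s * (‖x ⟨k, hkn⟩‖ ^ 2 - γ) ≤ (1 + t) * r := by
        have h1 : s * (‖x ⟨k, hkn⟩‖ ^ 2 - γ) ≤ |‖x ⟨k, hkn⟩‖ ^ 2 - γ| := by
          refine (le_abs_self _).trans ?_
          rw [abs_mul, habs, one_mul]
        have h2 : t * √(ξ * γ) ≤ t * r := by gcongr
        linarith
      have step := potential_step_bound (T := (G * G).trace) (Φ := G.trace) (h' := h') hn1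
        (by linarith : (k : ℝ) ≤ n) hξ hγ (by linarith : 1 ≤ 1 + t) hr hr2 hnξr hh hh'ge
        hGG0 (hpot.trans hΦ) hd
        (hp.trans (by
          gcongr
          have : -s * k ≤ 1 * k := by gcongr
          have : (γ + s * h') * G.trace ≤ (γ + 2 * h) * G.trace := by gcongr
          linarith))
        (hq.trans (by
          gcongr
          have : -s * G.trace ≤ 1 * G.trace := by gcongr
          have : (γ + s * h') * (G * G).trace ≤ (γ + 2 * h) * (G * G).trace := by gcongr
          linarith))
      have hb := barrier_succ Y (γ := γ) (h := h') hss hN' (by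
        rw [hYX, hYl]
        linarith [step.1])
      refine ⟨hb.1, ?_⟩
      rw [hb.2, hYX, hYl]
      push_cast
      exact step.2
  have := (main n le_rfl).1
  have hlast : h + n * (h / n) = 2 * h := by rw [mul_div_cancel₀ _ hn0.ne']; ring
  rwa [hlast] at this

theorem norm_gram_sub_le_of_goodSample {H : Type*} [NormedAddCommGroup H] [InnerProductSpace ℝ H]
    {n : ℕ} (x : Fin n → H) {ξ γ t h : ℝ} (hn : 0 < n) (hξ : 0 < ξ) (hγ : 0 < γ)
    (ht : 0 ≤ t) (hnξ : n * ξ / γ ≤ 1 / 2) (hh : h = 64 * (1 + t) * √(n * ξ * γ))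
    (hgood : ∀ k : ℕ, ∀ hk : k < n, ∀ s : ℝ, s = 1 ∨ s = -1 →
      GoodSample (fun i : Fin k => x (Fin.castLE hk.le i)) (x ⟨k, hk⟩) ξ γ h
        (h + (k + 1) * (h / n)) s t) :
    ‖Matrix.toEuclideanCLM (𝕜 := ℝ)
      (Matrix.gram ℝ x - γ • (1 : Matrix (Fin n) (Fin n) ℝ))‖ ≤ 2 * h := by
  have h₁ := (barrier_posDef_of_goodSample x hn hξ hγ ht (Or.inl rfl) hnξ hh
    fun k hk => hgood k hk 1 (Or.inl rfl)).posSemidef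
  have h₂ := (barrier_posDef_of_goodSample x hn hξ hγ ht (Or.inr rfl) hnξ hh
    fun k hk => hgood k hk (-1) (Or.inr rfl)).posSemidef
  rw [barrier, one_smul] at h₁
  rw [barrier, neg_one_smul, sub_neg_eq_add] at h₂
  refine norm_toEuclideanCLM_le ?_ (by rw [hh]; positivity) h₁ h₂
  exact (Matrix.isHermitian_gram ℝ x).sub (by
    rw [Matrix.IsHermitian, Matrix.conjTranspose_smul, Matrix.conjTranspose_one]; simp)

/-! ### The covariance operator in its eigenbasis -/


section SecondMoment

variable {ι H : Type*} [NormedAddCommGroup H] [InnerProductSpace ℝ H]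
  [MeasurableSpace H] {μ : Measure H} {b : HilbertBasis ι ℝ H} {ξ : ι → ℝ}

theorem HasDiagonalCovariance.le_norm (hb : HasDiagonalCovariance μ b ξ) (j : ι) :
    ξ j ≤ ‖secondMoment μ‖ := by
  have h := (secondMoment μ).le_opNorm (b j)
  rw [hb.diagonal, norm_smul, b.orthonormal.1 j, mul_one, mul_one] at h
  exact (le_abs_self _).trans h

variable [SecondCountableTopology H] [BorelSpace H]

theorem integrable_rankOne (hμ : MemLp id 2 μ) :
    Integrable (fun x : H => InnerProductSpace.rankOne ℝ x x) μ := by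
  have hc : Continuous fun x : H => (InnerProductSpace.rankOne ℝ x x : H →L[ℝ] H) := by
    simp only [InnerProductSpace.rankOne_def]
    fun_prop
  have := (memLp_two_iff_integrable_sq_norm hμ.1).1 hμ
  refine this.mono' hc.aestronglyMeasurable (ae_of_all _ fun x => ?_)
  simp [sq]

variable [CompleteSpace H]

theorem inner_secondMoment (hμ : MemLp id 2 μ) (u v : H) :
    inner ℝ u (secondMoment μ v) = ∫ x, inner ℝ u x * inner ℝ x v ∂μ := by
  have hi := integrable_rankOne hμ
  rw [secondMoment, ContinuousLinearMap.integral_apply hi,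
    ← integral_inner (hi.apply_continuousLinearMap v)]
  refine integral_congr_ae (ae_of_all _ fun x => ?_)
  simp [real_inner_smul_right, mul_comm]

theorem HasDiagonalCovariance.inner_secondMoment_basis (hb : HasDiagonalCovariance μ b ξ)
    (j : ι) (u : H) : inner ℝ (b j) (secondMoment μ u) = ξ j * inner ℝ (b j) u := by
  have : inner ℝ (b j) (secondMoment μ u) = inner ℝ u (secondMoment μ (b j)) := by
    rw [inner_secondMoment hb.memLp, inner_secondMoment hb.memLp]
    refine integral_congr_ae (ae_of_all _ fun x => ?_)
    simp only [real_inner_comm, mul_comm]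
  rw [this, hb.diagonal, real_inner_smul_right, real_inner_comm]

theorem HasDiagonalCovariance.nonneg (hb : HasDiagonalCovariance μ b ξ) (j : ι) : 0 ≤ ξ j := by
  have h := inner_secondMoment hb.memLp (b j) (b j)
  rw [hb.inner_secondMoment_basis, real_inner_self_eq_norm_sq, b.orthonormal.1 j] at h
  have : ξ j = ∫ x, inner ℝ (b j) x * inner ℝ x (b j) ∂μ := by simpa using h
  rw [this]
  refine integral_nonneg fun x => ?_
  simp only [Pi.zero_apply, real_inner_comm x (b j)]
  exact mul_self_nonneg _

theorem HasDiagonalCovariance.opTrace_comp (hb : HasDiagonalCovariance μ b ξ) (A : H →L[ℝ] H) :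
    opTrace b (secondMoment μ ∘L A) = ∑' j, ξ j * inner ℝ (b j) (A (b j)) := by
  simp [opTrace, hb.inner_secondMoment_basis]

theorem HasDiagonalCovariance.opTrace_secondMoment (hb : HasDiagonalCovariance μ b ξ) :
    opTrace b (secondMoment μ) = ∑' j, ξ j := by
  simp [opTrace, hb.inner_secondMoment_basis, b.orthonormal.1]

/-- A sum that is not summable has the value `0`, so a positive trace forces summability. -/
theorem HasDiagonalCovariance.summable_of_opTrace_pos (hb : HasDiagonalCovariance μ b ξ)
    (h : 0 < opTrace b (secondMoment μ)) : Summable ξ := by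
  rw [hb.opTrace_secondMoment] at h
  by_contra hs
  rw [tsum_eq_zero_of_not_summable hs] at h
  exact h.false

theorem HasDiagonalCovariance.exists_pos (hb : HasDiagonalCovariance μ b ξ)
    (hγ : 0 < opTrace b (secondMoment μ)) : ∃ j, 0 < ξ j := by
  by_contra! h
  have : ∀ j, ξ j = 0 := fun j => le_antisymm (h j) (hb.nonneg j)
  rw [hb.opTrace_secondMoment] at hγ
  simp [this] at hγ

end SecondMoment

theorem _root_.ContinuousLinearMap.IsPositive.inner_sq_le {H : Type*} [NormedAddCommGroup H]
    [InnerProductSpace ℝ H] {A : H →L[ℝ] H} (hA : A.IsPositive) (u v : H) :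
    inner ℝ u (A v) ^ 2 ≤ inner ℝ u (A u) * inner ℝ v (A v) := by
  have hsymm : inner ℝ v (A u) = inner ℝ u (A v) := by
    rw [← hA.inner_left_eq_inner_right, real_inner_comm]
  have := discrim_le_zero (a := inner ℝ v (A v)) (b := 2 * inner ℝ u (A v))
    (c := inner ℝ u (A u)) fun t => by
      have := hA.inner_nonneg_right (u + t • v)
      simp only [map_add, map_smul, inner_add_left, inner_add_right, real_inner_smul_left,
        real_inner_smul_right, hsymm] at this
      linarith
  rw [discrim] at this
  linarith

section Sandwich

variable {ι H : Type*} [NormedAddCommGroup H] [InnerProductSpace ℝ H] {b : HilbertBasis ι ℝ H}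
  {ξ : ι → ℝ} {A : H →L[ℝ] H}

theorem sandwich_entry_sq_le (hξ : ∀ j, 0 ≤ ξ j) (hA : A.IsPositive) (p : ι × ι) :
    (√(ξ p.1) * inner ℝ (b p.1) (A (b p.2)) * √(ξ p.2)) ^ 2
      ≤ (ξ p.1 * inner ℝ (b p.1) (A (b p.1))) * (ξ p.2 * inner ℝ (b p.2) (A (b p.2))) := by
  rw [mul_pow, mul_pow, Real.sq_sqrt (hξ _), Real.sq_sqrt (hξ _)]
  have := mul_le_mul_of_nonneg_left (hA.inner_sq_le (b p.1) (b p.2))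
    (mul_nonneg (hξ p.1) (hξ p.2))
  linarith

theorem summable_weighted_diagonal (hξ : ∀ j, 0 ≤ ξ j) (hs : Summable ξ) (hA : A.IsPositive) :
    Summable fun j => ξ j * inner ℝ (b j) (A (b j)) := by
  refine Summable.of_nonneg_of_le (fun j => mul_nonneg (hξ j) (hA.inner_nonneg_right _))
    (fun j => mul_le_mul_of_nonneg_left ?_ (hξ j)) (hs.mul_right ‖A‖)
  refine (real_inner_le_norm _ _).trans ?_
  have := A.le_opNorm (b j)
  rw [b.orthonormal.1 j, mul_one] at this
  rwa [b.orthonormal.1 j, one_mul]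

theorem summable_sandwich_sq (hξ : ∀ j, 0 ≤ ξ j) (hs : Summable ξ) (hA : A.IsPositive) :
    Summable fun p : ι × ι =>
      (√(ξ p.1) * inner ℝ (b p.1) (A (b p.2)) * √(ξ p.2)) ^ 2 := by
  have hd := summable_weighted_diagonal (b := b) hξ hs hA
  have hd0 : ∀ j, 0 ≤ ξ j * inner ℝ (b j) (A (b j)) :=
    fun j => mul_nonneg (hξ j) (hA.inner_nonneg_right _)
  exact Summable.of_nonneg_of_le (fun _ => sq_nonneg _) (sandwich_entry_sq_le hξ hA)
    (hd.mul_of_nonneg hd hd0 hd0)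

/-- `‖Σ^{1/2} A Σ^{1/2}‖_F ≤ Tr (Σ A)`: the Frobenius norm of a positive semidefinite operator is at
most its trace. -/
theorem sandwichFrobenius_le (hξ : ∀ j, 0 ≤ ξ j) (hs : Summable ξ) (hA : A.IsPositive) :
    sandwichFrobenius b ξ A ≤ ∑' j, ξ j * inner ℝ (b j) (A (b j)) := by
  have hd := summable_weighted_diagonal (b := b) hξ hs hA
  have hd0 : ∀ j, 0 ≤ ξ j * inner ℝ (b j) (A (b j)) :=
    fun j => mul_nonneg (hξ j) (hA.inner_nonneg_right _)
  have hdd := hd.mul_of_nonneg hd hd0 hd0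
  refine Real.sqrt_le_iff.2 ⟨tsum_nonneg hd0, ?_⟩
  rw [sq, hd.tsum_mul_tsum hd hdd]
  exact (summable_sandwich_sq hξ hs hA).tsum_le_tsum (sandwich_entry_sq_le hξ hA) hdd

theorem sandwichFrobenius_pos (hξ : ∀ j, 0 ≤ ξ j) (hs : Summable ξ) (hA : A.IsPositive) {j : ι}
    (hj : 0 < ξ j) (hAj : 0 < inner ℝ (b j) (A (b j))) : 0 < sandwichFrobenius b ξ A :=
  Real.sqrt_pos.2 <| (summable_sandwich_sq hξ hs hA).tsum_pos (fun _ => sq_nonneg _) (j, j) <| by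
    positivity

/-- `‖Σ‖_F ≤ √(‖Σ‖ Tr Σ)`. -/
theorem sandwichFrobenius_one_le (hξ : ∀ j, 0 ≤ ξ j) (hs : Summable ξ) {ξ₁ : ℝ}
    (hξ₁ : ∀ j, ξ j ≤ ξ₁) : sandwichFrobenius b ξ 1 ≤ √(ξ₁ * ∑' j, ξ j) := by
  classical
  refine Real.sqrt_le_sqrt ?_
  have hone : ∀ p : ι × ι, (√(ξ p.1) * inner ℝ (b p.1) ((1 : H →L[ℝ] H) (b p.2)) * √(ξ p.2)) ^ 2
      = if p.1 = p.2 then ξ p.1 ^ 2 else 0 := by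
    rintro ⟨i, j⟩
    simp only [one_apply_eq_self, orthonormal_iff_ite.1 b.orthonormal]
    split_ifs with h
    · subst h
      rw [mul_one, Real.mul_self_sqrt (hξ i)]
    · simp
  have hinj : Function.Injective fun j : ι => (j, j) := fun i j h => congrArg Prod.fst h
  have hsum : ∑' p : ι × ι,
      (√(ξ p.1) * inner ℝ (b p.1) ((1 : H →L[ℝ] H) (b p.2)) * √(ξ p.2)) ^ 2
      = ∑' j, ξ j ^ 2 := by
    rw [← hinj.tsum_eq]
    · exact tsum_congr fun j => by rw [hone, if_pos rfl]
    · rintro ⟨i, j⟩ hp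
      rw [Function.mem_support, hone] at hp
      have hij : i = j := by by_contra h; simp [h] at hp
      exact ⟨i, by rw [hij]⟩
  rw [hsum, ← tsum_mul_left]
  have hle : ∀ j, ξ j ^ 2 ≤ ξ₁ * ξ j := fun j => by
    rw [sq]; exact mul_le_mul_of_nonneg_right (hξ₁ j) (hξ j)
  have hsm := hs.mul_left ξ₁
  exact (Summable.of_nonneg_of_le (fun _ => sq_nonneg _) hle hsm).tsum_le_tsum hle hsm

end Sandwich

/-! ### Tails of quadratic forms in the samples -/

section SampleOperator

variable {ι H : Type*} [NormedAddCommGroup H] [InnerProductSpace ℝ H] {k : ℕ}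

/-- The finite rank operator `∑ M a c • X a (X c)ᵀ`, whose quadratic form is `sampleForm X M`. -/
noncomputable def sampleOperator (X : Fin k → H) (M : Matrix (Fin k) (Fin k) ℝ) : H →L[ℝ] H :=
  ∑ a, ∑ c, M a c • InnerProductSpace.rankOne ℝ (X a) (X c)

theorem inner_sampleOperator (X : Fin k → H) (M : Matrix (Fin k) (Fin k) ℝ) (u v : H) :
    inner ℝ u (sampleOperator X M v)
      = ∑ a, ∑ c, M a c * (inner ℝ (X a) u * inner ℝ (X c) v) := by
  simp only [sampleOperator, sum_apply, smul_apply,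
    InnerProductSpace.rankOne_apply, inner_sum, real_inner_smul_right, real_inner_comm u]
  refine Finset.sum_congr rfl fun a _ => Finset.sum_congr rfl fun c _ => by ring

theorem inner_sampleOperator_self (X : Fin k → H) (M : Matrix (Fin k) (Fin k) ℝ) (y : H) :
    inner ℝ y (sampleOperator X M y) = sampleForm X M y := by
  rw [inner_sampleOperator, sampleForm, dotProduct]
  simp only [Matrix.mulVec, dotProduct, Finset.mul_sum]
  refine Finset.sum_congr rfl fun a _ => Finset.sum_congr rfl fun c _ => by ring

theorem sampleOperator_isPositive (X : Fin k → H) {M : Matrix (Fin k) (Fin k) ℝ}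
    (hM : M.PosSemidef) : (sampleOperator X M).IsPositive := by
  rw [ContinuousLinearMap.isPositive_iff]
  constructor
  · intro u v
    have hsymm : ∀ a c, M a c = M c a := fun a c => (hM.isHermitian.apply a c).symm
    change inner ℝ (sampleOperator X M u) v = inner ℝ u (sampleOperator X M v)
    rw [real_inner_comm, inner_sampleOperator, inner_sampleOperator, Finset.sum_comm]
    refine Finset.sum_congr rfl fun a _ => Finset.sum_congr rfl fun c _ => ?_
    rw [hsymm]; ring
  · intro u
    rw [real_inner_comm, inner_sampleOperator_self]
    exact hM.dotProduct_mulVec_nonneg _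

/-- `Tr (∑ M a c • X a (X c)ᵀ) = tr (M K)`, with `K` the Gram matrix of `X`. -/
theorem hasSum_diagonal_sampleOperator (b : HilbertBasis ι ℝ H) (X : Fin k → H)
    (M : Matrix (Fin k) (Fin k) ℝ) :
    HasSum (fun j => inner ℝ (b j) (sampleOperator X M (b j))) (M * Matrix.gram ℝ X).trace := by
  have : (M * Matrix.gram ℝ X).trace = ∑ a, ∑ c, M a c * inner ℝ (X a) (X c) := by
    simp only [Matrix.trace, Matrix.diag_apply, Matrix.mul_apply, Matrix.gram_apply]
    refine Finset.sum_congr rfl fun a _ => Finset.sum_congr rfl fun c _ => ?_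
    rw [real_inner_comm]
  rw [this]
  simp only [inner_sampleOperator]
  refine hasSum_sum fun a _ => hasSum_sum fun c _ => HasSum.mul_left _ ?_
  simpa only [real_inner_comm] using b.hasSum_inner_mul_inner (X a) (X c)

end SampleOperator

section Concentration

variable {ι H : Type*} [NormedAddCommGroup H] [InnerProductSpace ℝ H] [CompleteSpace H]
  [SecondCountableTopology H] [MeasurableSpace H] [BorelSpace H] {μ : Measure H}
  [IsProbabilityMeasure μ] {b : HilbertBasis ι ℝ H} {ξ : ι → ℝ} {c C β : ℝ}

/-- The upper tail of a quadratic form for fixed earlier samples `X`. The slack `η` gives room for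
adding a multiple of the identity to the operator, so that the concentration hypothesis, which
excludes `Σ^{1/2} A Σ^{1/2} = 0`, applies without a case distinction. -/
theorem IsConcentrated.sampleForm_tail (hcon : IsConcentrated μ b ξ c C β)
    (hb : HasDiagonalCovariance μ b ξ) (hγ : 0 < opTrace b (secondMoment μ)) {k : ℕ}
    (X : Fin k → H) {M : Matrix (Fin k) (Fin k) ℝ} (hM : M.PosSemidef) {t η : ℝ} (ht : 0 < t)
    (hη : 0 < η) :
    μ.real {y | (1 + t) * (‖secondMoment μ‖ * (M * Matrix.gram ℝ X).trace + η)
        ≤ sampleForm X M y} ≤ C * Real.exp (-c * t ^ (1 / β)) := by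
  set γ := opTrace b (secondMoment μ) with hγ_def
  have hs := hb.summable_of_opTrace_pos hγ
  obtain ⟨j₀, hj₀⟩ := hb.exists_pos hγ
  -- The multiple of the identity with `Tr (Σ (ε • 1)) = η`.
  set ε := η / γ with hε_def
  have hε : 0 < ε := div_pos hη hγ
  set A : H →L[ℝ] H := sampleOperator X M + ε • 1 with hA_def
  have hone : (1 : H →L[ℝ] H).IsPositive := ContinuousLinearMap.isPositive_one
  have hA₀ := sampleOperator_isPositive X hM
  have hA : A.IsPositive := hA₀.add (hone.smul_of_nonneg hε.le)
  have hinner : ∀ y, inner ℝ y (A y) = sampleForm X M y + ε * ‖y‖ ^ 2 := fun y => by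
    simp [hA_def, inner_add_right, inner_sampleOperator_self, real_inner_smul_right]
  have hdiag : ∀ j, ξ j * inner ℝ (b j) (A (b j))
      = ξ j * inner ℝ (b j) (sampleOperator X M (b j)) + ε * ξ j := fun j => by
    rw [hinner, inner_sampleOperator_self, b.orthonormal.1 j]; ring
  have hpos : 0 < sandwichFrobenius b ξ A := by
    refine sandwichFrobenius_pos hb.nonneg hs hA hj₀ ?_
    rw [hinner, b.orthonormal.1, ← inner_sampleOperator_self]
    have := hA₀.inner_nonneg_right (b j₀)
    linarith
  have hsd := hasSum_diagonal_sampleOperator b X M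
  have htr : opTrace b (secondMoment μ ∘L A)
      ≤ ‖secondMoment μ‖ * (M * Matrix.gram ℝ X).trace + η := by
    rw [hb.opTrace_comp]
    have hεs : HasSum (fun j => ε * ξ j) η := by
      have := hs.hasSum.mul_left ε
      rwa [← hb.opTrace_secondMoment, ← hγ_def, hε_def, div_mul_cancel₀ _ hγ.ne'] at this
    refine hasSum_le (fun j => ?_) (summable_weighted_diagonal hb.nonneg hs hA).hasSum
      ((hsd.mul_left _).add hεs)
    rw [hdiag]
    have := mul_le_mul_of_nonneg_right (hb.le_norm j) (hA₀.inner_nonneg_right (b j))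
    linarith
  have hF : sandwichFrobenius b ξ A ≤ opTrace b (secondMoment μ ∘L A) := by
    rw [hb.opTrace_comp]
    exact sandwichFrobenius_le hb.nonneg hs hA
  refine le_trans (measureReal_mono (fun y hy => ?_)) (hcon A hA hpos t ht)
  simp only [Set.mem_ofPred_eq] at hy ⊢
  refine le_trans ?_ (le_abs_self _)
  rw [hinner]
  have h1 : t * sandwichFrobenius b ξ A ≤ t * opTrace b (secondMoment μ ∘L A) := by gcongr
  have h2 : 0 ≤ ε * ‖y‖ ^ 2 := by positivity
  have h3 : (1 + t) * opTrace b (secondMoment μ ∘L A)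
      ≤ (1 + t) * (‖secondMoment μ‖ * (M * Matrix.gram ℝ X).trace + η) := by gcongr
  linarith

theorem IsConcentrated.norm_sq_tail (hcon : IsConcentrated μ b ξ c C β)
    (hb : HasDiagonalCovariance μ b ξ) (hγ : 0 < opTrace b (secondMoment μ)) {t : ℝ}
    (ht : 0 < t) :
    μ.real {y | t * √(‖secondMoment μ‖ * opTrace b (secondMoment μ))
        ≤ |‖y‖ ^ 2 - opTrace b (secondMoment μ)|} ≤ C * Real.exp (-c * t ^ (1 / β)) := by
  have hs := hb.summable_of_opTrace_pos hγ
  obtain ⟨j₀, hj₀⟩ := hb.exists_pos hγ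
  have hone : (1 : H →L[ℝ] H).IsPositive := ContinuousLinearMap.isPositive_one
  have hpos : 0 < sandwichFrobenius b ξ (1 : H →L[ℝ] H) :=
    sandwichFrobenius_pos hb.nonneg hs hone hj₀ (by simp [b.orthonormal.1])
  have hF := sandwichFrobenius_one_le (b := b) hb.nonneg hs hb.le_norm
  rw [← hb.opTrace_secondMoment] at hF
  refine le_trans (measureReal_mono (fun y hy => ?_)) (hcon 1 hone hpos t ht)
  simp only [Set.mem_ofPred_eq] at hy ⊢
  refine le_trans (by gcongr) (hy.trans_eq ?_)
  have : secondMoment μ ∘L (1 : H →L[ℝ] H) = secondMoment μ := by ext; simp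
  simp [this]

end Concentration

/-! ### Measurability and independence -/


theorem isClosed_setOf_posSemidef (m : Type*) [Fintype m] :
    IsClosed {M : m → m → ℝ | (Matrix.of M).PosSemidef} := by
  have : {M : m → m → ℝ | (Matrix.of M).PosSemidef}
      = {M | ∀ i j, M j i = M i j} ∩ ⋂ v : m → ℝ, {M | 0 ≤ ∑ i, v i * ∑ j, M i j * v j} := by
    ext M
    simp only [Set.mem_ofPred_eq, Set.mem_inter_iff, Set.mem_iInter]
    rw [Matrix.posSemidef_iff_dotProduct_mulVec]
    refine and_congr ⟨fun h i j => ?_, fun h => ?_⟩ Iff.rfl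
    · exact h.apply i j
    · exact Matrix.IsHermitian.ext fun i j => h i j
  rw [this]
  refine IsClosed.inter ?_ (isClosed_iInter fun v => isClosed_le (by fun_prop) (by fun_prop))
  simp only [Set.ofPred_forall]
  exact isClosed_iInter fun i => isClosed_iInter fun j => isClosed_eq (by fun_prop) (by fun_prop)

section Measurability

variable {H : Type*} [NormedAddCommGroup H] [InnerProductSpace ℝ H]
  [SecondCountableTopology H] [MeasurableSpace H] [BorelSpace H] {k : ℕ}

theorem measurable_inv_barrier_apply (s γ h : ℝ) (a c : Fin k) :
    Measurable fun X : Fin k → H => (barrier X s γ h)⁻¹ a c := by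
  have hc : Continuous fun X : Fin k → H => barrier X s γ h := by
    refine continuous_matrix fun i j => ?_
    simp only [barrier, Matrix.sub_apply, Matrix.smul_apply, Matrix.gram_apply]
    fun_prop
  simp only [Matrix.inv_def, Matrix.smul_apply, Ring.inverse_eq_inv', smul_eq_mul]
  exact hc.matrix_det.measurable.inv.mul (hc.matrix_adjugate.matrix_elem a c).measurable

theorem measurableSet_sampleForm_tail {M : (Fin k → H) → Matrix (Fin k) (Fin k) ℝ}
    (hM : ∀ a c, Measurable fun X => M X a c) (τ ξ₁ η : ℝ) :
    MeasurableSet {p : (Fin k → H) × H | (M p.1).PosSemidef ∧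
      τ * (ξ₁ * (M p.1 * Matrix.gram ℝ p.1).trace + η) ≤ sampleForm p.1 (M p.1) p.2} := by
  have hM' : ∀ a c, Measurable fun p : (Fin k → H) × H => M p.1 a c :=
    fun a c => (hM a c).comp measurable_fst
  rw [Set.ofPred_and]
  refine MeasurableSet.inter ?_ (measurableSet_le ?_ ?_)
  · have : Measurable fun p : (Fin k → H) × H => Matrix.of.symm (M p.1) :=
      measurable_pi_iff.2 fun a => measurable_pi_iff.2 fun c => hM' a c
    exact this (isClosed_setOf_posSemidef (Fin k)).measurableSet
  · simp only [Matrix.trace, Matrix.diag_apply, Matrix.mul_apply, Matrix.gram_apply]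
    fun_prop
  · simp only [sampleForm, dotProduct, Matrix.mulVec]
    fun_prop

end Measurability

/-- Conditioning on the first of two independent variables: a bound on the probability of every
section of `S` bounds the probability of `S`. -/
theorem measureReal_le_of_indepFun {Ω E F : Type*} [MeasurableSpace Ω] [MeasurableSpace E]
    [MeasurableSpace F] {P : Measure Ω} [IsProbabilityMeasure P] {μ : Measure F}
    [IsProbabilityMeasure μ] {Z : Ω → E} {y : Ω → F} (hZ : AEMeasurable Z P)
    (hy : HasLaw y μ P) (hind : IndepFun Z y P) {S : Set (E × F)} (hS : MeasurableSet S) {δ : ℝ}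
    (hδ : 0 ≤ δ) (h : ∀ z, μ.real {w | (z, w) ∈ S} ≤ δ) :
    P.real {ω | (Z ω, y ω) ∈ S} ≤ δ := by
  have hmap := hind.map_prod_eq_prod_map_map hZ hy.aemeasurable
  rw [hy.map_eq] at hmap
  have : IsProbabilityMeasure (P.map Z) := Measure.isProbabilityMeasure_map hZ
  refine ENNReal.toReal_le_of_le_ofReal hδ ?_
  calc P {ω | (Z ω, y ω) ∈ S} = P.map (fun ω => (Z ω, y ω)) S :=
        (Measure.map_apply_of_aemeasurable (hZ.prodMk hy.aemeasurable) hS).symm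
    _ = ∫⁻ z, μ (Prod.mk z ⁻¹' S) ∂P.map Z := by rw [hmap, Measure.prod_apply hS]
    _ ≤ ∫⁻ _, ENNReal.ofReal δ ∂P.map Z :=
        lintegral_mono fun z => (ENNReal.le_ofReal_iff_toReal_le (measure_ne_top _ _) hδ).2 (h z)
    _ = ENNReal.ofReal δ := by simp

theorem indepFun_prefix {Ω E : Type*} [MeasurableSpace Ω] [MeasurableSpace E] {P : Measure Ω}
    {n : ℕ} {x : Fin n → Ω → E} (hx : ∀ i, AEMeasurable (x i) P) (hind : iIndepFun x P)
    {k : ℕ} (hk : k < n) :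
    IndepFun (fun ω (i : Fin k) => x (Fin.castLE hk.le i) ω) (x ⟨k, hk⟩) P := by
  have hdisj : Disjoint (Finset.Iio (⟨k, hk⟩ : Fin n)) {⟨k, hk⟩} := by simp
  have h := hind.indepFun_finset₀ _ _ hdisj hx
  have hmem : ∀ i : Fin k, Fin.castLE hk.le i ∈ Finset.Iio (⟨k, hk⟩ : Fin n) := fun i => by
    rw [Finset.mem_Iio, Fin.lt_def]; exact i.2
  have hφ : Measurable fun (z : Finset.Iio (⟨k, hk⟩ : Fin n) → E) (i : Fin k) =>
      z ⟨_, hmem i⟩ := measurable_pi_iff.2 fun i => measurable_pi_apply _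
  have hψ : Measurable fun z : ({⟨k, hk⟩} : Finset (Fin n)) → E =>
      z ⟨⟨k, hk⟩, Finset.mem_singleton_self _⟩ := measurable_pi_apply _
  exact h.comp hφ hψ

/-! ### Probability of the good event -/

section GramTail

variable {ι H Ω : Type*} [NormedAddCommGroup H] [InnerProductSpace ℝ H] [CompleteSpace H]
  [SecondCountableTopology H] [MeasurableSpace H] [BorelSpace H] {μ : Measure H}
  [IsProbabilityMeasure μ] {b : HilbertBasis ι ℝ H} {ξ : ι → ℝ} {c C β : ℝ}
  [MeasurableSpace Ω] {P : Measure Ω} [IsProbabilityMeasure P]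

theorem IsConcentrated.sampleForm_tail_of_indepFun (hcon : IsConcentrated μ b ξ c C β)
    (hb : HasDiagonalCovariance μ b ξ) (hγ : 0 < opTrace b (secondMoment μ)) (hC : 0 < C) {k : ℕ}
    {Z : Ω → Fin k → H} {y : Ω → H} (hZ : AEMeasurable Z P) (hy : HasLaw y μ P)
    (hind : IndepFun Z y P) {M : (Fin k → H) → Matrix (Fin k) (Fin k) ℝ}
    (hM : ∀ a c, Measurable fun X => M X a c) {t η : ℝ} (ht : 0 < t) (hη : 0 < η) :
    P.real {ω | (M (Z ω)).PosSemidef ∧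
      (1 + t) * (‖secondMoment μ‖ * (M (Z ω) * Matrix.gram ℝ (Z ω)).trace + η)
        ≤ sampleForm (Z ω) (M (Z ω)) (y ω)} ≤ C * Real.exp (-c * t ^ (1 / β)) := by
  refine measureReal_le_of_indepFun hZ hy hind
    (measurableSet_sampleForm_tail hM (1 + t) ‖secondMoment μ‖ η) (by positivity) fun z => ?_
  by_cases hz : (M z).PosSemidef
  · refine le_trans (measureReal_mono fun w hw => ?_)
      (hcon.sampleForm_tail hb hγ z hz ht hη)
    exact hw.2
  · have : {w : H | (z, w) ∈ {p : (Fin k → H) × H | (M p.1).PosSemidef ∧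
        (1 + t) * (‖secondMoment μ‖ * (M p.1 * Matrix.gram ℝ p.1).trace + η)
          ≤ sampleForm p.1 (M p.1) p.2}} = ∅ :=
      Set.eq_empty_of_forall_notMem fun w hw => hz hw.1
    rw [this, measureReal_empty]
    positivity

/-- A sample independent of `Z` fails to be well-behaved for one of the two signs with probability at
most `5 C exp (-c t ^ (1 / β))`: two quadratic forms for each sign, and the squared norm. -/
theorem IsConcentrated.not_goodSample_le (hcon : IsConcentrated μ b ξ c C β)
    (hb : HasDiagonalCovariance μ b ξ) (hγ : 0 < opTrace b (secondMoment μ)) (hC : 0 < C)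
    (hξ₁ : 0 < ‖secondMoment μ‖) {k : ℕ} {Z : Ω → Fin k → H} {y : Ω → H}
    (hZ : AEMeasurable Z P) (hy : HasLaw y μ P) (hind : IndepFun Z y P) {t h : ℝ} (h' : ℝ)
    (ht : 0 < t) (hh : 0 < h) :
    P.real {ω | ¬ ∀ s : ℝ, s = 1 ∨ s = -1 →
      GoodSample (Z ω) (y ω) ‖secondMoment μ‖ (opTrace b (secondMoment μ)) h h' s t}
      ≤ 5 * (C * Real.exp (-c * t ^ (1 / β))) := by
  set ξ₁ := ‖secondMoment μ‖ with hξ₁_def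
  set γ := opTrace b (secondMoment μ) with hγ_def
  set δ := C * Real.exp (-c * t ^ (1 / β)) with hδ
  have hm₁ : ∀ s : ℝ, ∀ i j, Measurable fun X : Fin k → H => (barrier X s γ h')⁻¹ i j :=
    fun s => measurable_inv_barrier_apply s γ h'
  have hm₂ : ∀ s : ℝ, ∀ i j, Measurable fun X : Fin k → H =>
      ((barrier X s γ h')⁻¹ * (barrier X s γ h')⁻¹) i j := fun s i j => by
    simp only [Matrix.mul_apply]
    exact Finset.measurable_sum _ fun l _ => (hm₁ s i l).mul (hm₁ s l j)
  let B₁ : ℝ → Set Ω := fun s => {ω | (barrier (Z ω) s γ h')⁻¹.PosSemidef ∧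
    (1 + t) * (ξ₁ * ((barrier (Z ω) s γ h')⁻¹ * Matrix.gram ℝ (Z ω)).trace + ξ₁)
      ≤ sampleForm (Z ω) (barrier (Z ω) s γ h')⁻¹ (y ω)}
  let B₂ : ℝ → Set Ω := fun s => {ω |
    ((barrier (Z ω) s γ h')⁻¹ * (barrier (Z ω) s γ h')⁻¹).PosSemidef ∧
    (1 + t) * (ξ₁ * ((barrier (Z ω) s γ h')⁻¹ * (barrier (Z ω) s γ h')⁻¹ *
      Matrix.gram ℝ (Z ω)).trace + ξ₁ / h)
      ≤ sampleForm (Z ω) ((barrier (Z ω) s γ h')⁻¹ * (barrier (Z ω) s γ h')⁻¹) (y ω)}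
  let B₃ : Set Ω := {ω | t * √(ξ₁ * γ) ≤ |‖y ω‖ ^ 2 - γ|}
  have hB₁ : ∀ s, P.real (B₁ s) ≤ δ := fun s =>
    hcon.sampleForm_tail_of_indepFun hb hγ hC hZ hy hind (hm₁ s) ht hξ₁
  have hB₂ : ∀ s, P.real (B₂ s) ≤ δ := fun s =>
    hcon.sampleForm_tail_of_indepFun hb hγ hC hZ hy hind (hm₂ s) ht (div_pos hξ₁ hh)
  have hB₃ : P.real B₃ ≤ δ := by
    refine (hy.measureReal_eq (p := fun y => t * √(ξ₁ * γ) ≤ |‖y‖ ^ 2 - γ|)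
      (measurableSet_le (by fun_prop) (by fun_prop))).trans_le ?_
    exact hcon.norm_sq_tail hb hγ ht
  have hsub : {ω | ¬ ∀ s : ℝ, s = 1 ∨ s = -1 → GoodSample (Z ω) (y ω) ξ₁ γ h h' s t}
      ⊆ (B₁ 1 ∪ B₂ 1) ∪ (B₁ (-1) ∪ B₂ (-1)) ∪ B₃ := by
    intro ω hω
    by_contra hn
    simp only [Set.mem_union, not_or] at hn
    obtain ⟨⟨⟨n₁, n₂⟩, n₃, n₄⟩, n₅⟩ := hn
    refine hω fun s hs => ?_
    have m₁ : ω ∉ B₁ s := by rcases hs with rfl | rfl <;> assumption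
    have m₂ : ω ∉ B₂ s := by rcases hs with rfl | rfl <;> assumption
    exact ⟨fun h => not_le.1 fun h' => m₁ ⟨h, h'⟩, fun h => not_le.1 fun h' => m₂ ⟨h, h'⟩,
      not_le.1 n₅⟩
  have u₁ := measureReal_union_le (μ := P) ((B₁ 1 ∪ B₂ 1) ∪ (B₁ (-1) ∪ B₂ (-1))) B₃
  have u₂ := measureReal_union_le (μ := P) (B₁ 1 ∪ B₂ 1) (B₁ (-1) ∪ B₂ (-1))
  have u₃ := measureReal_union_le (μ := P) (B₁ 1) (B₂ 1)
  have u₄ := measureReal_union_le (μ := P) (B₁ (-1)) (B₂ (-1))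
  have := measureReal_mono (μ := P) hsub
  linarith [hB₁ 1, hB₁ (-1), hB₂ 1, hB₂ (-1)]

/-- The deviation of the Gram matrix at a free scale `t`. -/
theorem IsConcentrated.norm_gram_sub_le (hcon : IsConcentrated μ b ξ c C β)
    (hb : HasDiagonalCovariance μ b ξ) (hγ : 0 < opTrace b (secondMoment μ)) (hC : 0 < C)
    {n : ℕ} (hn : 0 < n) {x : Fin n → Ω → H} (hx : ∀ i, HasLaw (x i) μ P)
    (hind : iIndepFun x P)
    (hnξ : n * ‖secondMoment μ‖ / opTrace b (secondMoment μ) ≤ 1 / 2) {t : ℝ} (ht : 0 < t) :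
    1 - 5 * n * (C * Real.exp (-c * t ^ (1 / β))) ≤
      P.real {ω | ‖Matrix.toEuclideanCLM (𝕜 := ℝ) (Matrix.gram ℝ (fun i => x i ω)
          - opTrace b (secondMoment μ) • (1 : Matrix (Fin n) (Fin n) ℝ))‖
        ≤ 128 * (1 + t) * √(n * ‖secondMoment μ‖ * opTrace b (secondMoment μ))} := by
  have hξ₁ : 0 < ‖secondMoment μ‖ := by
    obtain ⟨j, hj⟩ := hb.exists_pos hγ
    exact hj.trans_le (hb.le_norm j)
  have hn0 : (0 : ℝ) < n := by exact_mod_cast hn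
  set ξ₁ := ‖secondMoment μ‖ with hξ₁_def
  set γ := opTrace b (secondMoment μ) with hγ_def
  set δ := C * Real.exp (-c * t ^ (1 / β)) with hδ
  set h := 64 * (1 + t) * √(n * ξ₁ * γ) with hh
  have hh0 : 0 < h := by positivity
  let B : Fin n → Set Ω := fun k => {ω | ¬ ∀ s : ℝ, s = 1 ∨ s = -1 →
    GoodSample (fun i : Fin k => x (Fin.castLE k.2.le i) ω) (x k ω) ξ₁ γ h
      (h + (k + 1) * (h / n)) s t}
  have hB : ∀ k, P.real (B k) ≤ 5 * δ := fun k =>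
    hcon.not_goodSample_le hb hγ hC hξ₁
      (Z := fun ω (i : Fin k) => x (Fin.castLE k.2.le i) ω)
      (aemeasurable_pi_iff.2 fun i => (hx _).aemeasurable) (hx k)
      (indepFun_prefix (fun i => (hx i).aemeasurable) hind k.2) _ ht hh0
  set G := {ω | ‖Matrix.toEuclideanCLM (𝕜 := ℝ) (Matrix.gram ℝ (fun i => x i ω)
          - γ • (1 : Matrix (Fin n) (Fin n) ℝ))‖ ≤ 128 * (1 + t) * √(n * ξ₁ * γ)} with hG
  have hcover : Set.univ ⊆ G ∪ ⋃ k, B k := by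
    intro ω _
    by_cases hω : ω ∈ ⋃ k, B k
    · exact Or.inr hω
    · left
      simp only [Set.mem_iUnion, not_exists] at hω
      have := norm_gram_sub_le_of_goodSample (fun i => x i ω) hn hξ₁ hγ ht.le hnξ hh
        fun k hk => not_not.1 (hω ⟨k, hk⟩)
      refine this.trans_eq ?_
      rw [hh]; ring
  have h₁ : P.real (⋃ k, B k) ≤ n * (5 * δ) := by
    refine (measureReal_iUnion_fintype_le B).trans ?_
    refine (Finset.sum_le_sum fun k _ => hB k).trans_eq ?_
    simp
  have h₂ := measureReal_mono (μ := P) hcover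
  have h₃ := measureReal_union_le (μ := P) G (⋃ k, B k)
  rw [probReal_univ] at h₂
  linarith

end GramTail

/-! ### Choice of the scale -/

theorem union_bound_le_rpow_neg {c C β D : ℝ} (hc : 0 < c) (hC : 0 < C) (hβ : 0 < β) (hD : 0 < D)
    {n : ℕ} (hn : 2 ≤ n) :
    5 * n * (C * Real.exp (-c * (((D + 1 + 10 * C) / c * Real.log n) ^ β) ^ (1 / β)))
      ≤ (n : ℝ) ^ (-D) := by
  have hn0 : (0 : ℝ) < n := by positivity
  have hn2 : (2 : ℝ) ≤ n := by exact_mod_cast hn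
  have hlog : 1 / 2 ≤ Real.log n := by
    have := Real.log_le_log two_pos hn2
    linarith [Real.log_two_gt_d9]
  have hL : 0 ≤ (D + 1 + 10 * C) / c * Real.log n := by positivity
  rw [← Real.rpow_mul hL, mul_one_div_cancel hβ.ne', Real.rpow_one]
  have he : -c * ((D + 1 + 10 * C) / c * Real.log n)
      = Real.log n * (-D) - Real.log n - 10 * C * Real.log n := by field_simp; ring
  rw [he, Real.exp_sub, Real.exp_sub, Real.exp_log hn0, ← Real.rpow_def_of_pos hn0]
  have h5 : 5 * C ≤ Real.exp (10 * C * Real.log n) := by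
    have := Real.add_one_le_exp (10 * C * Real.log n)
    nlinarith
  have hp : 0 < (n : ℝ) ^ (-D) := Real.rpow_pos_of_pos hn0 _
  have : 5 * n * (C * ((n : ℝ) ^ (-D) / n / Real.exp (10 * C * Real.log n)))
      = (n : ℝ) ^ (-D) * (5 * C / Real.exp (10 * C * Real.log n)) := by field_simp
  rw [this]
  exact mul_le_of_le_one_right hp.le ((div_le_one (Real.exp_pos _)).2 h5)

theorem one_add_rpow_le {L β ℓ : ℝ} (hL : 0 ≤ L) (hβ : 0 < β) (hℓ : 1 / 2 ≤ ℓ) :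
    1 + (L * ℓ) ^ β ≤ (2 ^ (2 * β + 1) + L ^ β * 2 ^ (β + 1)) * ℓ ^ (2 * β + 1) := by
  have hℓ0 : 0 < ℓ := by linarith
  have h1 : 1 ≤ (2 : ℝ) ^ (2 * β + 1) * ℓ ^ (2 * β + 1) := by
    rw [← Real.mul_rpow two_pos.le hℓ0.le]
    exact Real.one_le_rpow (by linarith) (by linarith)
  have h2 : 1 ≤ (2 : ℝ) ^ (β + 1) * ℓ ^ (β + 1) := by
    rw [← Real.mul_rpow two_pos.le hℓ0.le]
    exact Real.one_le_rpow (by linarith) (by linarith)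
  have h3 : ℓ ^ (2 * β + 1) = ℓ ^ β * ℓ ^ (β + 1) := by
    rw [← Real.rpow_add hℓ0]; ring_nf
  rw [Real.mul_rpow hL hℓ0.le, add_mul]
  have h4 : 0 ≤ L ^ β * ℓ ^ β := by positivity
  have := le_mul_of_one_le_right h4 h2
  rw [h3] at h1 ⊢
  linarith

end ConcentratedFeatures

theorem proposition2 (c C β D : ℝ) (hc : 0 < c) (hC : 0 < C) (hβ : 0 < β) (hD : 0 < D) :
    ∃ K : ℝ, 0 < K ∧
      ∀ (ι H Ω : Type*) [NormedAddCommGroup H] [InnerProductSpace ℝ H] [CompleteSpace H]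
        [SecondCountableTopology H] [MeasurableSpace H] [BorelSpace H]
        (μ : Measure H) [IsProbabilityMeasure μ] (b : HilbertBasis ι ℝ H) (ξ : ι → ℝ)
        [MeasurableSpace Ω] (P : Measure Ω) [IsProbabilityMeasure P]
        (n : ℕ) (x : Fin n → Ω → H) (γ ξ₁ : ℝ),
        ConcentratedFeatures.HasDiagonalCovariance μ b ξ →
        ConcentratedFeatures.IsConcentrated μ b ξ c C β →
        0 < n →
        (∀ i, HasLaw (x i) μ P) →
        iIndepFun x P →
        γ = ConcentratedFeatures.opTrace b (ConcentratedFeatures.secondMoment μ) →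
        ξ₁ = ‖ConcentratedFeatures.secondMoment μ‖ →
        0 < γ →
        n * ξ₁ / γ ≤ 1 / 2 →
        1 - (n : ℝ) ^ (-D) ≤
          P.real {ω | ‖Matrix.toEuclideanCLM (𝕜 := ℝ)
              (Matrix.gram ℝ (fun i => x i ω) - γ • (1 : Matrix (Fin n) (Fin n) ℝ))‖
            ≤ K * Real.log n ^ (2 * β + 1) * γ * √(n * ξ₁ / γ)} := by
  set L := (D + 1 + 10 * C) / c with hL
  have hL0 : 0 < L := by positivity
  refine ⟨128 * (2 ^ (2 * β + 1) + L ^ β * 2 ^ (β + 1)), by positivity, ?_⟩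
  intro ι H Ω _ _ _ _ _ _ μ _ b ξ _ P _ n x γ ξ₁ hb hcon hn hx hind hγ hξ₁ hγ0 hnξ
  rcases Nat.lt_or_ge n 2 with hn2 | hn2
  -- For a single sample the claimed probability is `1 - 1 ^ (-D) = 0`.
  · obtain rfl : n = 1 := by omega
    simp
  have hn2' : (2 : ℝ) ≤ n := by exact_mod_cast hn2
  have hlog : 1 / 2 ≤ Real.log n := by
    have := Real.log_le_log two_pos hn2'
    linarith [Real.log_two_gt_d9]
  subst hγ hξ₁
  have hmain := hcon.norm_gram_sub_le hb hγ0 hC hn hx hind hnξ (t := (L * Real.log n) ^ β)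
    (by positivity)
  refine le_trans (by linarith [ConcentratedFeatures.union_bound_le_rpow_neg hc hC hβ hD hn2])
    (hmain.trans (measureReal_mono fun ω hω => ?_))
  refine le_trans (Set.mem_ofPred_eq ▸ hω) ?_
  have hsqrt : ∀ γ ξ₁ : ℝ, 0 < γ → √(n * ξ₁ * γ) = γ * √(n * ξ₁ / γ) := fun γ ξ₁ hγ => by
    rw [show n * ξ₁ * γ = γ ^ 2 * (n * ξ₁ / γ) by field_simp, Real.sqrt_mul (sq_nonneg γ),
      Real.sqrt_sq hγ.le]
  rw [hsqrt _ _ hγ0, ← mul_assoc]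
  refine mul_le_mul_of_nonneg_right (mul_le_mul_of_nonneg_right ?_ hγ0.le) (Real.sqrt_nonneg _)
  rw [mul_assoc 128 (_ + _)]
  have := ConcentratedFeatures.one_add_rpow_le hL0.le hβ hlog
  gcongr
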